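/- A stochastic graph $G=(U,V,E)$ consists of finite sets $U$ (offline vertices) and $V$ (online vertices), $E=U\times V$, edge probabilities $p_{u,v}\in[0,1]$, real edge weights $w_{u,v}$ and patience values $\ell_v\in\mathbb{N}$ for $v \in V$; the states of the edges are independent, and $(u,v)$ is active with probability $p_{u,v}$. A committal probing algorithm adaptively (possibly with randomization) probes edges of $G$, in any order, each edge at most once and at most $\ell_v$ edges at each $v\in V$; a probe reveals the state of the edge, and a probed active edge is added to the current matching exactly when both its endpoints are unmatched. $\mathrm{OPT}(G)$ is the largest expected weight of the final matching that such an algorithm can attain. A known i.i.d. input $(G,\boldsymbol r,n)$ consists of a stochastic (type) graph $G=(U,V,E)$, an integer $n\ge 1$, and rates $r_v>0$ for $v\in V$ with $\sum_{v\in V}r_v=n$. Draw $v_1,\dots,v_n$ independently from $V$ with $\Pr[v_t=v]=r_v/n$. The instantiated graph $\hat G$ is the stochastic graph with offline vertices $U$ and $n$ distinct online vertices $1,\dots,n$, where $t$ has the edge probabilities, edge weights and patience of $v_t$. Put $\mathrm{OPT}(G,\boldsymbol r,n):=\mathbb{E}[\mathrm{OPT}(\hat G)]$, the expectation being over $v_1,\dots,v_n$.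 Let $U^{(\le k)}$ be the set of tuples of distinct elements of $U$ of length between $1$ and $k$, and for $v \in V$, $\boldsymbol u=(u_1,\dots,u_m)\in U^{(\le \ell_v)}$ and $1\le i\le m$ let $g_v^i(\boldsymbol u):=p_{u_i,v}\prod_{j<i}(1-p_{u_j,v})$. Let $\mathrm{LPOPT}_{new\text{-}iid}(G,\boldsymbol r,n)$ be the optimum value of the linear program \[ \begin{aligned} \text{maximize}\quad & \sum_{v\in V}\sum_{\boldsymbol u\in U^{(\le \ell_v)}}\Big(\sum_{i=1}^{|\boldsymbol u|}w_{u_i,v}\,g_v^i(\boldsymbol u)\Big)\,y_v(\boldsymbol u)\\ \text{subject to}\quad & \sum_{v\in V}\sum_{i=1}^{\ell_v}\ \sum_{\boldsymbol u^*\in U^{(\le \ell_v)}:\,u_i^*=u}g_v^i(\boldsymbol u^*)\,y_v(\boldsymbol u^*)\le 1 && \text{for all } u\in U,\\ & \sum_{\boldsymbol u\in U^{(\le \ell_v)}}y_v(\boldsymbol u)\le r_v && \text{for all } v\in V,\\ & y_v(\boldsymbol u)\ge 0 && \text{for all } v\in V,\ \boldsymbol u\in U^{(\le \ell_v)}. \end{aligned}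 \] Then, for every known i.i.d. input $(G,\boldsymbol r,n)$, this linear program has an optimal solution and \[ \mathrm{OPT}(G,\boldsymbol r,n)\le \mathrm{LPOPT}_{new\text{-}iid}(G,\boldsymbol r,n). \] -/

import Mathlib

/-- A stochastic bipartite graph with offline vertices `U`, online vertices `V` and edge set
`U × V`: edge probabilities, (real) edge weights and patience values of the online vertices. -/
structure StochasticGraph (U V : Type*) where
  prob : U → V → ℝ
  weight : U → V → ℝ
  patience : V → ℕ
  prob_nonneg : ∀ u v, 0 ≤ prob u v
  prob_le_one : ∀ u v, prob u v ≤ 1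

/-- A deterministic adaptive probing strategy, as a decision tree: either halt, or probe the edge
`(u, v)` and continue according to whether it is found inactive or active. -/
inductive ProbingTree (U V : Type*) where
  | halt : ProbingTree U V
  | probe (u : U) (v : V) (ifInactive ifActive : ProbingTree U V) : ProbingTree U V

namespace ProbingTree

variable {U V : Type*} [DecidableEq U] [DecidableEq V]

/-- `T.Admissible ℓ P`: after the edges in `P` have been probed, continuing with `T` never probes
an edge a second time and never makes more than `ℓ v` probes to edges at `v`. -/
def Admissible (ℓ : V → ℕ) : ProbingTree U V → Finset (U × V) → Prop
  | halt, _ => True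
  | probe u v T₀ T₁, P =>
      (u, v) ∉ P ∧ (P.filter fun e => e.2 = v).card < ℓ v ∧
        T₀.Admissible ℓ (insert (u, v) P) ∧ T₁.Admissible ℓ (insert (u, v) P)

/-- The matching returned when `T` is executed on the edge states `st` (`true` is active), starting
from the current matching `M`. Commitment: a probed edge that is active is added to the
current matching exactly when both of its endpoints are unmatched. -/
def run (st : U × V → Bool) : ProbingTree U V → Finset (U × V) → Finset (U × V)
  | halt, M => M
  | probe u v T₀ T₁, M =>
      if st (u, v) = true then
        if ∀ e ∈ M, e.1 ≠ u ∧ e.2 ≠ v then T₁.run st (insert (u, v) M) else T₁.run st M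
      else T₀.run st M

end ProbingTree

noncomputable section

namespace StochasticGraph

variable {U V : Type*}

/-- The probability of the vector of edge states `st`, the states being independent Bernoulli
variables with the edge probabilities as parameters. -/
def stateProb [Fintype U] [Fintype V] (G : StochasticGraph U V) (st : U × V → Bool) : ℝ :=
  ∏ e : U × V, if st e = true then G.prob e.1 e.2 else 1 - G.prob e.1 e.2

/-- The deterministic committal (offline) probing algorithms for `G`. -/
def DetAlgorithm [DecidableEq U] [DecidableEq V] (G : StochasticGraph U V) : Type _ :=
  {T : ProbingTree U V // T.Admissible G.patience ∅}

/-- The expected weight, over the edge states, of the matching returned by `A`. -/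
def detValue [Fintype U] [Fintype V] [DecidableEq U] [DecidableEq V] (G : StochasticGraph U V)
    (A : G.DetAlgorithm) : ℝ :=
  ∑ st : U × V → Bool, G.stateProb st * ∑ e ∈ A.1.run st ∅, G.weight e.1 e.2

/-- The expected weight of the matching returned by a randomized committal probing algorithm, that
is by a random deterministic one, drawn independently of the edge states. -/
def algValue [Fintype U] [Fintype V] [DecidableEq U] [DecidableEq V] (G : StochasticGraph U V)
    (μ : PMF G.DetAlgorithm) : ℝ :=
  ∑' A : G.DetAlgorithm, (μ A).toReal * G.detValue A

/-- The committal benchmark `OPT(G)`: the largest expected value of a (possibly randomized)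
committal probing algorithm on `G`. -/
def OPT [Fintype U] [Fintype V] [DecidableEq U] [DecidableEq V] (G : StochasticGraph U V) : ℝ :=
  sSup (Set.range G.algValue)

/-- The supremum `OPT` is over a non-empty set. -/
theorem range_algValue_nonempty [Fintype U] [Fintype V] [DecidableEq U] [DecidableEq V]
    (G : StochasticGraph U V) : (Set.range G.algValue).Nonempty :=
  ⟨_, PMF.pure (⟨ProbingTree.halt, trivial⟩ : G.DetAlgorithm), rfl⟩

/-- The supremum `OPT` is over a bounded set. -/
theorem bddAbove_range_algValue [Fintype U] [Fintype V] [DecidableEq U] [DecidableEq V]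
    (G : StochasticGraph U V) : BddAbove (Set.range G.algValue) := by
  set C : ℝ := ∑ st : U × V → Bool, |G.stateProb st| * ∑ e : U × V, |G.weight e.1 e.2| with hC
  have hdet : ∀ A : G.DetAlgorithm, |G.detValue A| ≤ C := by
    intro A
    refine (Finset.abs_sum_le_sum_abs _ _).trans (Finset.sum_le_sum fun st _ => ?_)
    rw [abs_mul]
    refine mul_le_mul_of_nonneg_left ?_ (abs_nonneg _)
    refine (Finset.abs_sum_le_sum_abs _ _).trans ?_
    exact Finset.sum_le_sum_of_subset_of_nonneg (Finset.subset_univ _) fun _ _ _ => abs_nonneg _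
  refine ⟨C, ?_⟩
  rintro _ ⟨μ, rfl⟩
  have hμ : HasSum (fun A => (μ A).toReal) 1 := by
    have h := (ENNReal.summable_toReal μ.tsum_coe_ne_top).hasSum
    rwa [← ENNReal.tsum_toReal_eq (fun A => μ.apply_ne_top A), μ.tsum_coe,
      ENNReal.toReal_one] at h
  have hs : Summable fun A => (μ A).toReal * G.detValue A := by
    refine Summable.of_norm_bounded (hμ.summable.mul_right C) fun A => ?_
    rw [Real.norm_eq_abs, abs_mul, abs_of_nonneg ENNReal.toReal_nonneg]
    exact mul_le_mul_of_nonneg_left (hdet A) ENNReal.toReal_nonneg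
  have h2 := hs.tsum_le_tsum (fun A => mul_le_mul_of_nonneg_left
    ((le_abs_self _).trans (hdet A)) ENNReal.toReal_nonneg) (hμ.summable.mul_right C)
  rw [tsum_mul_right, hμ.tsum_eq, one_mul] at h2
  exact h2

end StochasticGraph

/-- An input `(G, r, n)` of the known i.i.d. stochastic matching problem: a type graph, a number of
arrivals and (fractional) arrival rates. -/
structure KnownIIDInput (U V : Type*) [Fintype V] where
  graph : StochasticGraph U V
  rounds : ℕ
  rate : V → ℝ
  one_le_rounds : 1 ≤ rounds
  rate_pos : ∀ v, 0 < rate v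
  sum_rate : ∑ v, rate v = (rounds : ℝ)

/-- `U^{(≤ ℓ)}`: the tuples of distinct elements of `U` of length between `1` and `ℓ`. -/
def ProbeSeq (U : Type*) (ℓ : ℕ) : Type _ :=
  {s : List U // s ≠ [] ∧ s.Nodup ∧ s.length ≤ ℓ}

instance ProbeSeq.instFintype (U : Type*) [Fintype U] (ℓ : ℕ) : Fintype (ProbeSeq U ℓ) :=
  haveI : Finite (ProbeSeq U ℓ) :=
    ((List.finite_length_le U ℓ).subset fun _ h => h.2.2).to_subtype
  Fintype.ofFinite _

/-- `g_v^i(s)`: the probability that `(s_i, v)` is the first active edge revealed when the edges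
between `v` and the entries of `s` are revealed in order. -/
def StochasticGraph.firstActiveProb {U V : Type*} (G : StochasticGraph U V) (v : V) (s : List U)
    (i : Fin s.length) : ℝ :=
  G.prob (s.get i) v * ∏ j ∈ Finset.Iio i, (1 - G.prob (s.get j) v)

namespace KnownIIDInput

variable {U V : Type*} [Fintype V]

/-- The instantiated graph, given that the type of the `t`-th arrival is `a t`. Its online vertices
are the arrivals; distinct arrivals of the same type are distinct vertices. -/
def instantiate (I : KnownIIDInput U V) (a : Fin I.rounds → V) :
    StochasticGraph U (Fin I.rounds) where
  prob u t := I.graph.prob u (a t)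
  weight u t := I.graph.weight u (a t)
  patience t := I.graph.patience (a t)
  prob_nonneg u t := I.graph.prob_nonneg u (a t)
  prob_le_one u t := I.graph.prob_le_one u (a t)

/-- The committal benchmark `OPT(G, r, n)`: the expectation of `OPT` of the instantiated graph, the
types of the arrivals being drawn independently from the distribution `r / n`. -/
def OPT [Fintype U] [DecidableEq U] (I : KnownIIDInput U V) : ℝ :=
  ∑ a : Fin I.rounds → V, (∏ t, I.rate (a t) / (I.rounds : ℝ)) * (I.instantiate a).OPT

/-- The variables of the linear program: one for each type node `v` and each `s ∈ U^{(≤ ℓ_v)}`. -/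
abbrev LPVar (I : KnownIIDInput U V) : Type _ :=
  (v : V) → ProbeSeq U (I.graph.patience v) → ℝ

/-- The constraints of LP-new-iid. -/
structure LPFeasible [Fintype U] [DecidableEq U] (I : KnownIIDInput U V) (y : I.LPVar) : Prop where
  matching : ∀ u : U, ∑ v, ∑ s : ProbeSeq U (I.graph.patience v),
    ∑ i : Fin s.1.length,
      (if s.1.get i = u then I.graph.firstActiveProb v s.1 i * y v s else 0) ≤ 1
  distribution : ∀ v : V, ∑ s : ProbeSeq U (I.graph.patience v), y v s ≤ I.rate v
  nonneg : ∀ v s, 0 ≤ y v s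

/-- The objective of LP-new-iid. -/
def lpObjective [Fintype U] (I : KnownIIDInput U V) (y : I.LPVar) : ℝ :=
  ∑ v, ∑ s : ProbeSeq U (I.graph.patience v),
    (∑ i : Fin s.1.length, I.graph.weight (s.1.get i) v * I.graph.firstActiveProb v s.1 i) * y v s

/-- The values of the feasible solutions of LP-new-iid. -/
def lpValues [Fintype U] [DecidableEq U] (I : KnownIIDInput U V) : Set ℝ :=
  I.lpObjective '' {y | I.LPFeasible y}

/-- The optimum of LP-new-iid. -/
def LPOPT [Fintype U] [DecidableEq U] (I : KnownIIDInput U V) : ℝ :=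
  sSup I.lpValues

end KnownIIDInput

end

/-! Fix a deterministic algorithm for every instantiation, and let x_v(u) be the expected number of
arrivals of type v matched to u. The objective and the matching constraint depend on a solution y
only through these marginals, so it suffices to write each x_v as a combination of first-active
probability vectors of probe sequences with nonnegative coefficients of sum at most r_v. These
combinations form a compact convex set, so by Hahn–Banach (`exists_weights_of_forall_le`) only
linear functionals c need checking. For one arrival, `exists_stateExp_run_le` bounds the adaptive
c-reward by that of one fixed sequence: probes not matching the arrival act only as randomization,
and the better branch can be kept. Averaging over arrivals gives the factor r_v. Each family of
algorithms thus has a feasible solution of equal value. Near-optimal families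
(`exists_OPT_lt_detValue_add`) then give the bound; compactness gives an optimal solution. -/

/-! ### Runs of probing trees. -/

namespace ProbingTree

variable {U V : Type*} [DecidableEq U] [DecidableEq V]

/-- Once `v` is matched, the edges at `v` in the matching do not change. -/
theorem mem_run_iff_of_matched (st : U × V → Bool) (v : V) (T : ProbingTree U V) :
    ∀ M : Finset (U × V), (∃ e ∈ M, e.2 = v) → ∀ u, ((u, v) ∈ T.run st M ↔ (u, v) ∈ M) := by
  induction T with
  | halt => intro M _ u; rfl
  | probe u' v' T₀ T₁ ih₀ ih₁ =>
    intro M hM u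
    simp only [run]
    split_ifs with h1 h2
    · obtain ⟨e, he, hev⟩ := hM
      have hv : v ≠ v' := fun h => (h2 e he).2 (hev.trans h)
      rw [ih₁ _ ⟨e, Finset.mem_insert_of_mem he, hev⟩ u, Finset.mem_insert]
      simp [hv]
    · exact ih₁ M hM u
    · exact ih₀ M hM u

/-- The matching matches each offline vertex at most once. -/
theorem injOn_fst_run (st : U × V → Bool) (T : ProbingTree U V) :
    ∀ M : Finset (U × V), Set.InjOn Prod.fst (M : Set (U × V)) →
      Set.InjOn Prod.fst (T.run st M : Set (U × V)) := by
  induction T with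
  | halt => intro M hM; exact hM
  | probe u v T₀ T₁ ih₀ ih₁ =>
    intro M hM
    simp only [run]
    split_ifs with h1 h2
    · refine ih₁ _ ?_
      rw [Finset.coe_insert]
      intro x hx y hy hxy
      rcases hx with rfl | hx <;> rcases hy with rfl | hy
      · rfl
      · exact absurd hxy.symm (h2 y hy).1
      · exact absurd hxy (h2 x hx).1
      · exact hM hx hy hxy
    · exact ih₁ M hM
    · exact ih₀ M hM

/-- The run of an admissible tree does not depend on the states of the edges probed before. -/
theorem run_update (ℓ : V → ℕ) (e : U × V) (b : Bool) (st : U × V → Bool) (T : ProbingTree U V) :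
    ∀ P M : Finset (U × V), e ∈ P → T.Admissible ℓ P →
      T.run (Function.update st e b) M = T.run st M := by
  induction T with
  | halt => intro P M _ _; rfl
  | probe u v T₀ T₁ ih₀ ih₁ =>
    intro P M he hT
    obtain ⟨hP, _, hT₀, hT₁⟩ := hT
    have hne : (u, v) ≠ e := fun h => hP (h ▸ he)
    have he' : e ∈ insert (u, v) P := Finset.mem_insert_of_mem he
    simp only [run, Function.update_of_ne hne, ih₀ _ _ he' hT₀, ih₁ _ _ he' hT₁]

end ProbingTree

noncomputable section

/-! ### The reward of a fixed probe sequence. -/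

namespace StochasticGraph

variable {U V : Type*}

/-- The expected reward when the edges between `v` and the entries of `s` are probed in order until
the first active one `(u, v)` is found, which is worth `c u`. -/
def firstActiveReward (G : StochasticGraph U V) (v : V) (c : U → ℝ) : List U → ℝ
  | [] => 0
  | u :: s => G.prob u v * c u + (1 - G.prob u v) * firstActiveReward G v c s

theorem firstActiveProb_cons_zero (G : StochasticGraph U V) (v : V) (u : U) (s : List U) :
    G.firstActiveProb v (u :: s) (0 : Fin (s.length + 1)) = G.prob u v := by
  have : Finset.Iio (0 : Fin (s.length + 1)) = ∅ := by
    ext j; simp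
  unfold firstActiveProb
  erw [this]
  simp

theorem firstActiveProb_cons_succ (G : StochasticGraph U V) (v : V) (u : U) (s : List U)
    (i : Fin s.length) :
    G.firstActiveProb v (u :: s) (i.succ : Fin (s.length + 1)) =
      (1 - G.prob u v) * G.firstActiveProb v s i := by
  have h : ∏ j ∈ Finset.Iio (i.succ : Fin (s.length + 1)), (1 - G.prob ((u :: s).get j) v) =
      (1 - G.prob u v) * ∏ j ∈ Finset.Iio i, (1 - G.prob (s.get j) v) := by
    -- Indicator factors turn the product into one over all of `Fin n`, from which the index 0
    -- splits off.
    have h1 : ∀ {n : ℕ} (k : Fin n) (f : Fin n → ℝ),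
        ∏ j ∈ Finset.Iio k, f j = ∏ j, if j < k then f j else 1 := by
      intro n k f
      rw [← Finset.prod_filter]
      congr 1
      ext j; simp
    rw [h1, h1, Fin.prod_univ_succ]
    simp
  unfold firstActiveProb
  erw [h]
  simp only [List.get_eq_getElem, Fin.val_succ, List.getElem_cons_succ]
  ring

/-- Conditioning on the first probe multiplies all later terms by its failure probability. This
links the coefficients of the linear program to the recursion matching the induction on trees. -/
theorem sum_mul_firstActiveProb (G : StochasticGraph U V) (v : V) (c : U → ℝ) (s : List U) :
    ∑ i : Fin s.length, c (s.get i) * G.firstActiveProb v s i = G.firstActiveReward v c s := by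
  induction s with
  | nil => rfl
  | cons u s ih =>
    have h := Fin.sum_univ_succ (n := s.length)
      (fun i => c ((u :: s).get i) * G.firstActiveProb v (u :: s) i)
    rw [firstActiveReward, ← ih, Finset.mul_sum]
    refine h.trans ?_
    rw [firstActiveProb_cons_zero]
    congr 1
    · simp [mul_comm]
    · refine Finset.sum_congr rfl fun i _ => ?_
      rw [firstActiveProb_cons_succ]
      simp only [List.get_eq_getElem, Fin.val_succ, List.getElem_cons_succ]
      ring

/-! ### Expectation over independent edge states. -/

section Expectation

variable [Fintype U] [Fintype V]

theorem stateProb_nonneg (G : StochasticGraph U V) (st : U × V → Bool) : 0 ≤ G.stateProb st := by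
  refine Finset.prod_nonneg fun e _ => ?_
  split_ifs
  · exact G.prob_nonneg _ _
  · exact sub_nonneg.2 (G.prob_le_one _ _)

variable [DecidableEq U] [DecidableEq V]

/-- The expectation of `F` over the independent edge states. -/
def stateExp (G : StochasticGraph U V) (F : (U × V → Bool) → ℝ) : ℝ :=
  ∑ st, G.stateProb st * F st

theorem stateExp_mono (G : StochasticGraph U V) {F F' : (U × V → Bool) → ℝ}
    (h : ∀ st, F st ≤ F' st) : G.stateExp F ≤ G.stateExp F' :=
  Finset.sum_le_sum fun st _ => mul_le_mul_of_nonneg_left (h st) (G.stateProb_nonneg st)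

theorem stateExp_sum (G : StochasticGraph U V) {ι : Type*} (S : Finset ι)
    (F : ι → (U × V → Bool) → ℝ) :
    G.stateExp (fun st => ∑ i ∈ S, F i st) = ∑ i ∈ S, G.stateExp (F i) := by
  simp only [stateExp, Finset.mul_sum]
  exact Finset.sum_comm

theorem stateExp_const_mul (G : StochasticGraph U V) (c : ℝ) (F : (U × V → Bool) → ℝ) :
    G.stateExp (fun st => c * F st) = c * G.stateExp F := by
  simp only [stateExp, Finset.mul_sum]
  exact Finset.sum_congr rfl fun st _ => by ring

theorem stateExp_const (G : StochasticGraph U V) (c : ℝ) : G.stateExp (fun _ => c) = c := by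
  have h : ∑ st : U × V → Bool, G.stateProb st = 1 := by
    have := Finset.prod_univ_sum (fun _ : U × V => (Finset.univ : Finset Bool))
      (fun e b => if b = true then G.prob e.1 e.2 else 1 - G.prob e.1 e.2)
    rw [Fintype.piFinset_univ] at this
    unfold stateProb
    rw [← this]
    simp
  rw [stateExp, ← Finset.sum_mul, h, one_mul]

/-- Conditioning on the state of the edge `e`, when it does not influence the two outcomes. -/
theorem stateExp_ite (G : StochasticGraph U V) (e : U × V) (F₁ F₀ : (U × V → Bool) → ℝ)
    (h₁ : ∀ st b, F₁ (Function.update st e b) = F₁ st)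
    (h₀ : ∀ st b, F₀ (Function.update st e b) = F₀ st) :
    G.stateExp (fun st => if st e = true then F₁ st else F₀ st) =
      G.prob e.1 e.2 * G.stateExp F₁ + (1 - G.prob e.1 e.2) * G.stateExp F₀ := by
  set p := G.prob e.1 e.2 with hp
  set τ : (U × V → Bool) → U × V → Bool := fun st => Function.update st e (!st e) with hτ
  have hinv : Function.Involutive τ := by
    intro st
    simp [hτ]
  have hflip : ∀ st, (if st e = true then 1 - p else p) * G.stateProb st =
      (if st e = true then p else 1 - p) * G.stateProb (τ st) := by
    intro st
    have hrest : ∏ x ∈ Finset.univ.erase e,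
        (if τ st x = true then G.prob x.1 x.2 else 1 - G.prob x.1 x.2) =
        ∏ x ∈ Finset.univ.erase e,
          (if st x = true then G.prob x.1 x.2 else 1 - G.prob x.1 x.2) := by
      refine Finset.prod_congr rfl fun x hx => ?_
      rw [hτ]
      simp only [Function.update_of_ne (Finset.ne_of_mem_erase hx)]
    unfold stateProb
    rw [← Finset.mul_prod_erase _ _ (Finset.mem_univ e),
      ← Finset.mul_prod_erase _ (fun x => if τ st x = true then _ else _) (Finset.mem_univ e),
      hrest]
    have hτe : τ st e = !st e := by simp [hτ]
    rw [hτe]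
    cases st e <;> simp [← hp] <;> ring
  -- Flipping the state of `e` swaps the two events and preserves `F`, so the restricted
  -- expectations are in ratio p : (1 - p). Cross-multiplying covers p = 0 and p = 1.
  have key : ∀ F : (U × V → Bool) → ℝ, (∀ st b, F (Function.update st e b) = F st) →
      (1 - p) * G.stateExp (fun st => if st e = true then F st else 0) =
        p * G.stateExp (fun st => if st e = true then 0 else F st) := by
    intro F hF
    unfold stateExp
    rw [Finset.mul_sum, Finset.mul_sum]
    refine Fintype.sum_equiv hinv.toPerm _ _ fun st => ?_
    have h2 : F (τ st) = F st := hF _ _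
    have hτe : τ st e = !st e := by simp [hτ]
    have h3 := hflip st
    simp only [Function.Involutive.coe_toPerm, hτe, h2]
    cases hst : st e
    · simp
    · simp only [hst, if_true] at h3
      simp only [if_true, Bool.not_true, Bool.false_eq_true, if_false]
      rw [← mul_assoc, h3, mul_assoc]
  have hadd : ∀ F : (U × V → Bool) → ℝ,
      G.stateExp (fun st => if st e = true then F st else 0) +
        G.stateExp (fun st => if st e = true then 0 else F st) = G.stateExp F := by
    intro F
    unfold stateExp
    rw [← Finset.sum_add_distrib]
    refine Finset.sum_congr rfl fun st _ => ?_
    dsimp only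
    split_ifs <;> simp
  have hsplit : G.stateExp (fun st => if st e = true then F₁ st else F₀ st) =
      G.stateExp (fun st => if st e = true then F₁ st else 0) +
        G.stateExp (fun st => if st e = true then 0 else F₀ st) := by
    unfold stateExp
    rw [← Finset.sum_add_distrib]
    refine Finset.sum_congr rfl fun st _ => ?_
    dsimp only
    split_ifs <;> simp
  rw [hsplit]
  linear_combination key F₁ h₁ - key F₀ h₀ + p * hadd F₁ + (1 - p) * hadd F₀

/-! ### From adaptive probing to a fixed sequence at one vertex. -/

/-- What an admissible tree gains from an unmatched online vertex `v` is at most what can be gained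
by probing a fixed sequence of unprobed edges at `v` up to the first active one. -/
theorem exists_stateExp_run_le (G : StochasticGraph U V) (v : V) (c : U → ℝ)
    (T : ProbingTree U V) :
    ∀ P M : Finset (U × V), T.Admissible G.patience P → (∀ e ∈ M, e.2 ≠ v) →
      (P.filter fun e => e.2 = v).card ≤ G.patience v →
      ∃ s : List U, s.Nodup ∧ (∀ u ∈ s, (u, v) ∉ P) ∧
        s.length + (P.filter fun e => e.2 = v).card ≤ G.patience v ∧
        G.stateExp (fun st => ∑ u, if (u, v) ∈ T.run st M then c u else 0) ≤
          G.firstActiveReward v c s := by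
  induction T with
  | halt =>
    intro P M _ hM hP
    refine ⟨[], List.nodup_nil, by simp, by simpa using hP, ?_⟩
    have : ∀ u, (u, v) ∉ M := fun u hu => hM _ hu rfl
    simp [ProbingTree.run, this, firstActiveReward, stateExp_const]
  | probe u' v' T₀ T₁ ih₀ ih₁ =>
    intro P M hT hM hP
    obtain ⟨hnP, hlt, hT₀, hT₁⟩ := hT
    have hpn := G.prob_nonneg u' v'
    have hp1 := G.prob_le_one u' v'
    have hmem : (u', v') ∈ insert (u', v') P := Finset.mem_insert_self _ _
    set M₁ := if ∀ e ∈ M, e.1 ≠ u' ∧ e.2 ≠ v' then insert (u', v') M else M with hM₁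
    have hstep : G.stateExp
        (fun st => ∑ u, if (u, v) ∈ (ProbingTree.probe u' v' T₀ T₁).run st M then c u else 0) =
        G.prob u' v' * G.stateExp (fun st => ∑ u, if (u, v) ∈ T₁.run st M₁ then c u else 0) +
        (1 - G.prob u' v') *
          G.stateExp (fun st => ∑ u, if (u, v) ∈ T₀.run st M then c u else 0) := by
      rw [← G.stateExp_ite (u', v')]
      · congr 1
        funext st
        simp only [ProbingTree.run, hM₁]
        split_ifs <;> rfl
      · intro st b
        simp only [ProbingTree.run_update G.patience _ b st T₁ _ _ hmem hT₁]
      · intro st b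
        simp only [ProbingTree.run_update G.patience _ b st T₀ _ _ hmem hT₀]
    have hcard : ((insert (u', v') P).filter fun e => e.2 = v).card =
        (P.filter fun e => e.2 = v).card + if v' = v then 1 else 0 := by
      rw [Finset.filter_insert]
      split_ifs with h
      · rw [Finset.card_insert_of_notMem]
        exact fun h' => hnP (Finset.mem_filter.1 h').1
      · rfl
    have hP' : ((insert (u', v') P).filter fun e => e.2 = v).card ≤ G.patience v := by
      rw [hcard]
      split_ifs with h
      · subst h; exact hlt
      · exact hP
    rw [hstep]
    obtain ⟨s₀, hs₀n, hs₀P, hs₀l, hs₀⟩ := ih₀ _ M hT₀ hM hP'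
    -- Only here can this probe match `v`. If active, the gain is settled as `c u'`; if inactive,
    -- `s₀` continues, so `u' :: s₀` has the required reward.
    by_cases hv : (∀ e ∈ M, e.1 ≠ u' ∧ e.2 ≠ v') ∧ v' = v
    · obtain ⟨hfree, rfl⟩ := hv
      rw [hcard, if_pos rfl] at hs₀l
      refine ⟨u' :: s₀, ?_, ?_, ?_, ?_⟩
      · exact List.nodup_cons.2 ⟨fun h => hs₀P _ h hmem, hs₀n⟩
      · intro u hu
        rcases List.mem_cons.1 hu with rfl | hu
        · exact hnP
        · exact fun h => hs₀P u hu (Finset.mem_insert_of_mem h)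
      · rw [List.length_cons]; omega
      · rw [firstActiveReward]
        refine add_le_add (le_of_eq ?_) (mul_le_mul_of_nonneg_left hs₀ (sub_nonneg.2 hp1))
        congr 1
        have hrun : ∀ st u, (u, v') ∈ T₁.run st M₁ ↔ u = u' := by
          intro st u
          rw [hM₁, if_pos hfree, ProbingTree.mem_run_iff_of_matched st v' T₁ _
            ⟨_, Finset.mem_insert_self _ _, rfl⟩, Finset.mem_insert]
          constructor
          · rintro (h | h)
            · exact congrArg Prod.fst h
            · exact absurd rfl (hM _ h)
          · rintro rfl; exact Or.inl rfl
        simp only [hrun, Finset.sum_ite_eq', Finset.mem_univ, if_true, stateExp_const]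
    · have hM₁v : ∀ e ∈ M₁, e.2 ≠ v := by
        intro e he
        rw [hM₁] at he
        split_ifs at he with hfree
        · rcases Finset.mem_insert.1 he with rfl | he
          · exact fun h => hv ⟨hfree, h⟩
          · exact hM e he
        · exact hM e he
      obtain ⟨s₁, hs₁n, hs₁P, hs₁l, hs₁⟩ := ih₁ _ M₁ hT₁ hM₁v hP'
      -- Either outcome leaves `v` unmatched, so the gain is an average over the two branches and
      -- the better sequence dominates it.
      rcases le_total (G.firstActiveReward v c s₀) (G.firstActiveReward v c s₁) with hle | hle
      · refine ⟨s₁, hs₁n, fun u hu h => hs₁P u hu (Finset.mem_insert_of_mem h), by omega, ?_⟩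
        nlinarith [mul_le_mul_of_nonneg_left hs₁ hpn,
          mul_le_mul_of_nonneg_left (hs₀.trans hle) (sub_nonneg.2 hp1)]
      · refine ⟨s₀, hs₀n, fun u hu h => hs₀P u hu (Finset.mem_insert_of_mem h), by omega, ?_⟩
        nlinarith [mul_le_mul_of_nonneg_left (hs₁.trans hle) hpn,
          mul_le_mul_of_nonneg_left hs₀ (sub_nonneg.2 hp1)]

/-! ### Matching probabilities and derandomization. -/

/-- The probability that the deterministic algorithm `A` matches `u` to `v`. -/
def matchProb (G : StochasticGraph U V) (A : G.DetAlgorithm) (u : U) (v : V) : ℝ :=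
  G.stateExp fun st => if (u, v) ∈ A.1.run st ∅ then 1 else 0

theorem sum_mul_matchProb (G : StochasticGraph U V) (A : G.DetAlgorithm) (v : V) (c : U → ℝ) :
    ∑ u, c u * G.matchProb A u v =
      G.stateExp (fun st => ∑ u, if (u, v) ∈ A.1.run st ∅ then c u else 0) := by
  rw [stateExp_sum]
  refine Finset.sum_congr rfl fun u _ => ?_
  rw [matchProb, ← stateExp_const_mul]
  simp

theorem detValue_eq_sum_matchProb (G : StochasticGraph U V) (A : G.DetAlgorithm) :
    G.detValue A = ∑ v, ∑ u, G.weight u v * G.matchProb A u v := by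
  simp only [sum_mul_matchProb]
  rw [← stateExp_sum]
  unfold detValue stateExp
  refine Finset.sum_congr rfl fun st _ => ?_
  congr 1
  dsimp only
  rw [Finset.sum_comm, ← Fintype.sum_prod_type'
    (f := fun u v => if (u, v) ∈ A.1.run st ∅ then G.weight u v else 0)]
  rw [← Finset.sum_filter]
  simp

theorem exists_sum_mul_matchProb_le (G : StochasticGraph U V) (A : G.DetAlgorithm) (v : V)
    (c : U → ℝ) : ∃ s : List U, s.Nodup ∧ s.length ≤ G.patience v ∧
      ∑ u, c u * G.matchProb A u v ≤ G.firstActiveReward v c s := by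
  obtain ⟨s, hs, _, hl, hle⟩ := G.exists_stateExp_run_le v c A.1 ∅ ∅ A.2 (by simp) (by simp)
  exact ⟨s, hs, by simpa using hl, (G.sum_mul_matchProb A v c).trans_le hle⟩

theorem sum_matchProb_le_one (G : StochasticGraph U V) (A : G.DetAlgorithm) (u : U) :
    ∑ v, G.matchProb A u v ≤ 1 := by
  unfold matchProb
  rw [← stateExp_sum]
  refine (G.stateExp_mono (F' := fun _ => 1) fun st => ?_).trans_eq (G.stateExp_const 1)
  rw [Finset.sum_boole]
  norm_cast
  refine Finset.card_le_one.2 fun v hv v' hv' => ?_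
  have h := A.1.injOn_fst_run st ∅ (by simp) (Finset.mem_coe.2 (Finset.mem_filter.1 hv).2)
    (Finset.mem_coe.2 (Finset.mem_filter.1 hv').2) rfl
  exact congrArg Prod.snd h

/-- Randomization does not help: `OPT` is a supremum over deterministic algorithms. -/
theorem exists_OPT_lt_detValue_add (G : StochasticGraph U V) {ε : ℝ} (hε : 0 < ε) :
    ∃ A : G.DetAlgorithm, G.OPT < G.detValue A + ε := by
  by_contra! hcon
  have hcon' : ∀ A, G.detValue A ≤ G.OPT - ε := fun A => by linarith [hcon A]
  have hhalt : G.detValue ⟨ProbingTree.halt, trivial⟩ = 0 := by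
    simp [detValue, ProbingTree.run]
  -- Needed for the non-summable case below, where the `tsum` takes its default value 0.
  have h0 : 0 ≤ G.OPT - ε := hhalt ▸ hcon' _
  have : G.OPT ≤ G.OPT - ε := by
    refine csSup_le G.range_algValue_nonempty ?_
    rintro _ ⟨μ, rfl⟩
    have hμ : HasSum (fun A => (μ A).toReal) 1 := by
      have h := (ENNReal.summable_toReal μ.tsum_coe_ne_top).hasSum
      rwa [← ENNReal.tsum_toReal_eq (fun A => μ.apply_ne_top A), μ.tsum_coe,
        ENNReal.toReal_one] at h
    unfold algValue
    by_cases hs : Summable fun A => (μ A).toReal * G.detValue A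
    · have h2 := hs.tsum_le_tsum (fun A => mul_le_mul_of_nonneg_left (hcon' A)
        ENNReal.toReal_nonneg) (hμ.summable.mul_right (G.OPT - ε))
      rwa [tsum_mul_right, hμ.tsum_eq, one_mul] at h2
    · rwa [tsum_eq_zero_of_not_summable hs]
  linarith

end Expectation

end StochasticGraph

/-! ### Random arrival types. -/

namespace KnownIIDInput

variable {U V : Type*} [Fintype V]

theorem firstActiveReward_instantiate (I : KnownIIDInput U V) (a : Fin I.rounds → V)
    (t : Fin I.rounds) (c : U → ℝ) (s : List U) :
    (I.instantiate a).firstActiveReward t c s = I.graph.firstActiveReward (a t) c s := by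
  induction s with
  | nil => rfl
  | cons u s ih => rw [StochasticGraph.firstActiveReward, ih]; rfl

/-- The probability that the arrivals have the types `a`. -/
def typeProb (I : KnownIIDInput U V) (a : Fin I.rounds → V) : ℝ :=
  ∏ t, I.rate (a t) / (I.rounds : ℝ)

theorem typeProb_nonneg (I : KnownIIDInput U V) (a : Fin I.rounds → V) : 0 ≤ I.typeProb a :=
  Finset.prod_nonneg fun _ _ => div_nonneg (I.rate_pos _).le (Nat.cast_nonneg _)

theorem rounds_ne_zero (I : KnownIIDInput U V) : (I.rounds : ℝ) ≠ 0 :=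
  Nat.cast_ne_zero.2 (Nat.one_le_iff_ne_zero.1 I.one_le_rounds)

theorem sum_rate_div (I : KnownIIDInput U V) : ∑ v, I.rate v / (I.rounds : ℝ) = 1 := by
  rw [← Finset.sum_div, I.sum_rate, div_self I.rounds_ne_zero]

theorem sum_typeProb (I : KnownIIDInput U V) : ∑ a, I.typeProb a = 1 := by
  classical
  have := Finset.prod_univ_sum (fun _ : Fin I.rounds => (Finset.univ : Finset V))
    (fun _ v => I.rate v / (I.rounds : ℝ))
  rw [Fintype.piFinset_univ] at this
  unfold typeProb
  rw [← this]
  simp [I.sum_rate_div]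

/-- The probability that the `t`-th arrival has type `v`. -/
theorem sum_typeProb_ite [DecidableEq V] (I : KnownIIDInput U V) (t : Fin I.rounds) (v : V) :
    ∑ a, I.typeProb a * (if a t = v then 1 else 0) = I.rate v / I.rounds := by
  -- The event is a product of conditions on single arrivals, trivial except at `t`, so the sum over
  -- types factors.
  have := Finset.prod_univ_sum (fun _ : Fin I.rounds => (Finset.univ : Finset V))
    (fun t' v' => I.rate v' / (I.rounds : ℝ) * if t' = t → v' = v then 1 else 0)
  rw [Fintype.piFinset_univ, Fintype.prod_eq_single t] at this
  · rw [Finset.sum_congr rfl, ← this]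
    · simp
    · intro a _
      rw [Finset.prod_mul_distrib, typeProb]
      congr 1
      rw [Fintype.prod_eq_single t]
      · simp
      · intro t' ht'; simp [ht']
  · intro t' ht'
    simp [ht', I.sum_rate_div]

/-- The expected number of arrivals of type `v`. -/
theorem sum_typeProb_mul_sum_ite [DecidableEq V] (I : KnownIIDInput U V) (v : V) :
    ∑ a, I.typeProb a * ∑ t, (if a t = v then 1 else 0) = I.rate v := by
  simp only [Finset.mul_sum]
  rw [Finset.sum_comm]
  simp only [sum_typeProb_ite, Finset.sum_const, Finset.card_univ, Fintype.card_fin, nsmul_eq_mul]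
  rw [mul_div_cancel₀ _ I.rounds_ne_zero]

/-! ### The linear program and its polytope. -/

variable [Fintype U] [DecidableEq U]

/-- The probability that `u` is the first active neighbour of `v` found along `s`. -/
def firstActiveAt (I : KnownIIDInput U V) (v : V) (s : List U) (u : U) : ℝ :=
  ∑ i : Fin s.length, if s.get i = u then I.graph.firstActiveProb v s i else 0

theorem sum_mul_firstActiveAt (I : KnownIIDInput U V) (v : V) (s : List U) (c : U → ℝ) :
    ∑ u, c u * I.firstActiveAt v s u = I.graph.firstActiveReward v c s := by
  rw [← StochasticGraph.sum_mul_firstActiveProb]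
  simp only [firstActiveAt, Finset.mul_sum]
  rw [Finset.sum_comm]
  refine Finset.sum_congr rfl fun i _ => ?_
  simp

/-- Nonnegativity and the distribution constraint confine each variable `y v s` to [0, r_v], and all
constraints are closed. -/
theorem isCompact_setOf_lpFeasible (I : KnownIIDInput U V) :
    IsCompact {y : I.LPVar | I.LPFeasible y} := by
  have hsub : {y : I.LPVar | I.LPFeasible y} ⊆
      Set.pi Set.univ fun v => Set.pi Set.univ fun _ => Set.Icc 0 (I.rate v) := by
    intro y hy v _ s _
    exact ⟨hy.nonneg v s, (Finset.single_le_sum (f := y v) (fun s _ => hy.nonneg v s)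
      (Finset.mem_univ s)).trans (hy.distribution v)⟩
  refine IsCompact.of_isClosed_subset (isCompact_univ_pi fun v => isCompact_univ_pi fun _ =>
    isCompact_Icc) ?_ hsub
  have heq : {y : I.LPVar | I.LPFeasible y} =
      {y | ∀ u : U, ∑ v, ∑ s : ProbeSeq U (I.graph.patience v), ∑ i : Fin s.1.length,
        (if s.1.get i = u then I.graph.firstActiveProb v s.1 i * y v s else 0) ≤ 1} ∩
      ({y | ∀ v : V, ∑ s : ProbeSeq U (I.graph.patience v), y v s ≤ I.rate v} ∩
        {y | ∀ v s, 0 ≤ y v s}) := by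
    ext y
    exact ⟨fun h => ⟨h.1, h.2, h.3⟩, fun h => ⟨h.1, h.2.1, h.2.2⟩⟩
  rw [heq]
  simp only [Set.ofPred_forall]
  refine IsClosed.inter ?_ (IsClosed.inter ?_ ?_)
  · refine isClosed_iInter fun u => isClosed_le ?_ continuous_const
    refine continuous_finsetSum _ fun v _ => continuous_finsetSum _ fun s _ =>
      continuous_finsetSum _ fun i _ => ?_
    split_ifs <;> fun_prop
  · exact isClosed_iInter fun v => isClosed_le (by fun_prop) continuous_const
  · exact isClosed_iInter fun v => isClosed_iInter fun s =>
      isClosed_le continuous_const (by fun_prop)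

theorem lpFeasible_zero (I : KnownIIDInput U V) : I.LPFeasible 0 where
  matching u := by simp
  distribution v := by simpa using (I.rate_pos v).le
  nonneg v s := le_rfl

theorem isGreatest_LPOPT (I : KnownIIDInput U V) : IsGreatest I.lpValues I.LPOPT := by
  refine IsCompact.isGreatest_sSup (I.isCompact_setOf_lpFeasible.image ?_)
    ⟨_, 0, I.lpFeasible_zero, rfl⟩
  unfold lpObjective
  fun_prop

/-- A vector `x` lies in the polytope spanned by the vectors of first-active probabilities of
sequences, scaled by `r`, if no linear functional separates it. -/
theorem exists_weights_of_forall_le (I : KnownIIDInput U V) (v : V) {r : ℝ} (hr : 0 ≤ r)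
    (x : U → ℝ)
    (hx : ∀ (c : U → ℝ) (b : ℝ), (∀ s : List U, s.Nodup → s.length ≤ I.graph.patience v →
      r * I.graph.firstActiveReward v c s ≤ b) → ∑ u, c u * x u ≤ b) :
    ∃ z : ProbeSeq U (I.graph.patience v) → ℝ, (∀ s, 0 ≤ z s) ∧ ∑ s, z s ≤ r ∧
      ∀ u, x u = ∑ s, z s * I.firstActiveAt v s.1 u := by
  classical
  -- The total mass may fall short of `r`: the slack stands for the empty sequence, which is not a
  -- variable.
  set S : Set (ProbeSeq U (I.graph.patience v) → ℝ) := {z | (∀ s, 0 ≤ z s) ∧ ∑ s, z s ≤ r} with hS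
  set L : (ProbeSeq U (I.graph.patience v) → ℝ) →ₗ[ℝ] (U → ℝ) :=
    { toFun := fun z u => ∑ s, z s * I.firstActiveAt v s.1 u
      map_add' := fun z z' => by
        funext u; simp [add_mul, Finset.sum_add_distrib]
      map_smul' := fun a z => by
        funext u; simp [Finset.mul_sum, mul_assoc] } with hL
  have hLapp : ∀ z u, L z u = ∑ s, z s * I.firstActiveAt v s.1 u := fun z u => rfl
  suffices h : x ∈ L '' S by
    obtain ⟨z, hz, rfl⟩ := h
    exact ⟨z, hz.1, hz.2, fun u => rfl⟩
  have hconv : Convex ℝ S := by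
    intro z hz z' hz' a b ha hb hab
    refine ⟨fun s => add_nonneg (mul_nonneg ha (hz.1 s)) (mul_nonneg hb (hz'.1 s)), ?_⟩
    simp only [Pi.add_apply, Pi.smul_apply, smul_eq_mul, Finset.sum_add_distrib, ← Finset.mul_sum]
    calc _ ≤ a * r + b * r := add_le_add (mul_le_mul_of_nonneg_left hz.2 ha)
            (mul_le_mul_of_nonneg_left hz'.2 hb)
      _ = r := by rw [← add_mul, hab, one_mul]
  have hcomp : IsCompact S := by
    refine IsCompact.of_isClosed_subset
      (isCompact_univ_pi fun _ => isCompact_Icc (a := (0 : ℝ)) (b := r)) ?_ ?_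
    · rw [hS, Set.ofPred_and, Set.ofPred_forall]
      exact (isClosed_iInter fun s => isClosed_le continuous_const (by fun_prop)).inter
        (isClosed_le (by fun_prop) continuous_const)
    · intro z hz s _
      exact ⟨hz.1 s, (Finset.single_le_sum (f := z) (fun s _ => hz.1 s)
        (Finset.mem_univ s)).trans hz.2⟩
  by_contra hmem
  obtain ⟨f, b, hfb, hbx⟩ := geometric_hahn_banach_closed_point (hconv.linear_image L)
    (hcomp.image L.continuous_of_finiteDimensional).isClosed hmem
  have hf : ∀ w : U → ℝ, f w = ∑ u, f (Pi.single u 1) * w u := by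
    intro w
    conv_lhs => rw [pi_eq_sum_univ' w, map_sum]
    refine Finset.sum_congr rfl fun u _ => ?_
    rw [map_smul, smul_eq_mul, mul_comm]
  refine absurd (hx (fun u => f (Pi.single u 1)) b ?_) (not_le.2 (hf x ▸ hbx))
  intro s hsn hsl
  -- The empty sequence is tested by the point 0 of `S`, any other by the vertex with mass `r` at
  -- that sequence.
  by_cases hs : s = []
  · subst hs
    have := hfb _ ⟨0, ⟨fun _ => le_rfl, by simpa using hr⟩, rfl⟩
    simpa [StochasticGraph.firstActiveReward] using this.le
  · obtain ⟨σ, rfl⟩ : ∃ σ : ProbeSeq U (I.graph.patience v), σ.1 = s :=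
      ⟨⟨s, hs, hsn, hsl⟩, rfl⟩
    have h1 := hfb _ ⟨Pi.single σ r, ⟨fun σ' => ?_, by simp⟩, rfl⟩
    · rw [hf] at h1
      refine le_trans (le_of_eq ?_) h1.le
      rw [← sum_mul_firstActiveAt, Finset.mul_sum]
      refine Finset.sum_congr rfl fun u _ => ?_
      rw [hLapp, Fintype.sum_eq_single σ fun σ' hσ' => by simp [hσ'], Pi.single_eq_same]
      ring
    · rw [Pi.single_apply]
      split_ifs
      · exact hr
      · exact le_rfl

/-! ### From algorithms to feasible solutions. -/

/-- Any family of deterministic algorithms, one for each instantiation, induces a feasible solution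
of the linear program with the same value. -/
theorem sum_typeProb_mul_detValue_mem_lpValues (I : KnownIIDInput U V)
    (A : ∀ a, (I.instantiate a).DetAlgorithm) :
    ∑ a, I.typeProb a * (I.instantiate a).detValue (A a) ∈ I.lpValues := by
  classical
  set x : V → U → ℝ := fun v u => ∑ a, I.typeProb a *
    ∑ t, if a t = v then (I.instantiate a).matchProb (A a) u t else 0 with hxdef
  have hpair : ∀ v (c : U → ℝ), ∑ u, c u * x v u = ∑ a, I.typeProb a *
      ∑ t, if a t = v then ∑ u, c u * (I.instantiate a).matchProb (A a) u t else 0 := by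
    intro v c
    simp only [hxdef, Finset.mul_sum]
    rw [Finset.sum_comm]
    refine Finset.sum_congr rfl fun a _ => ?_
    rw [Finset.sum_comm]
    refine Finset.sum_congr rfl fun t _ => ?_
    split_ifs
    · rw [Finset.mul_sum]
      exact Finset.sum_congr rfl fun u _ => by ring
    · simp
  have hsep : ∀ v, ∃ z : ProbeSeq U (I.graph.patience v) → ℝ, (∀ s, 0 ≤ z s) ∧
      ∑ s, z s ≤ I.rate v ∧ ∀ u, x v u = ∑ s, z s * I.firstActiveAt v s.1 u := by
    intro v
    refine I.exists_weights_of_forall_le v (I.rate_pos v).le (x v) fun c b hb => ?_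
    rw [hpair]
    -- Each arrival of type `v` earns at most `b / r_v`, and `r_v` of them are expected.
    calc _ ≤ ∑ a, I.typeProb a * ∑ t, (if a t = v then 1 else 0) * (b / I.rate v) := by
          refine Finset.sum_le_sum fun a _ => mul_le_mul_of_nonneg_left
            (Finset.sum_le_sum fun t _ => ?_) (I.typeProb_nonneg a)
          split_ifs with hat
          · obtain ⟨s, hsn, hsl, hle⟩ :=
              (I.instantiate a).exists_sum_mul_matchProb_le (A a) t c
            rw [firstActiveReward_instantiate, hat] at hle
            have hsl' : s.length ≤ I.graph.patience v := hat ▸ hsl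
            rw [one_mul]
            refine hle.trans ((le_div_iff₀' (I.rate_pos v)).2 (hb s hsn hsl'))
          · simp
      _ = b := by
          simp only [← Finset.sum_mul, ← mul_assoc]
          rw [sum_typeProb_mul_sum_ite, mul_div_cancel₀ _ (I.rate_pos v).ne']
  choose y hy0 hyr hyx using hsep
  -- Every arrival has exactly one type, so summing over types removes the indicator.
  have hsum : ∀ (a : Fin I.rounds → V) (f : V → Fin I.rounds → ℝ),
      ∑ v, ∑ t, (if a t = v then f v t else 0) = ∑ t, f (a t) t := by
    intro a f
    rw [Finset.sum_comm]
    exact Finset.sum_congr rfl fun t _ => by simp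
  refine ⟨y, ⟨fun u => ?_, hyr, hy0⟩, ?_⟩
  · calc _ = ∑ v, x v u := by
          refine Finset.sum_congr rfl fun v _ => ?_
          rw [hyx]
          refine Finset.sum_congr rfl fun s _ => ?_
          rw [firstActiveAt, Finset.mul_sum]
          refine Finset.sum_congr rfl fun i _ => ?_
          split_ifs
          · ring
          · simp
      _ = ∑ a, I.typeProb a * ∑ t, (I.instantiate a).matchProb (A a) u t := by
          simp only [hxdef]
          rw [Finset.sum_comm]
          simp only [← Finset.mul_sum, hsum]
      _ ≤ ∑ a, I.typeProb a := by
          refine Finset.sum_le_sum fun a _ => ?_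
          exact mul_le_of_le_one_right (I.typeProb_nonneg a)
            ((I.instantiate a).sum_matchProb_le_one (A a) u)
      _ = 1 := I.sum_typeProb
  · calc I.lpObjective y = ∑ v, ∑ u, I.graph.weight u v * x v u := by
          refine Finset.sum_congr rfl fun v _ => ?_
          simp only [hyx, Finset.mul_sum]
          rw [Finset.sum_comm]
          refine Finset.sum_congr rfl fun s _ => ?_
          rw [I.graph.sum_mul_firstActiveProb v (fun u => I.graph.weight u v),
            ← sum_mul_firstActiveAt, Finset.sum_mul]
          exact Finset.sum_congr rfl fun u _ => by ring
      _ = _ := by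
          simp only [hpair]
          rw [Finset.sum_comm]
          refine Finset.sum_congr rfl fun a _ => ?_
          rw [← Finset.mul_sum, hsum a fun v t =>
            ∑ u, I.graph.weight u v * (I.instantiate a).matchProb (A a) u t,
            StochasticGraph.detValue_eq_sum_matchProb]
          rfl

theorem OPT_le_LPOPT (I : KnownIIDInput U V) : I.OPT ≤ I.LPOPT := by
  refine le_of_forall_pos_le_add fun ε hε => ?_
  choose A hA using fun a => (I.instantiate a).exists_OPT_lt_detValue_add hε
  calc I.OPT ≤ ∑ a, I.typeProb a * ((I.instantiate a).detValue (A a) + ε) :=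
        Finset.sum_le_sum fun a _ =>
          mul_le_mul_of_nonneg_left (hA a).le (I.typeProb_nonneg a)
    _ = ∑ a, I.typeProb a * (I.instantiate a).detValue (A a) + ε := by
        simp only [mul_add, Finset.sum_add_distrib, ← Finset.sum_mul, I.sum_typeProb, one_mul]
    _ ≤ I.LPOPT + ε := by
        gcongr
        exact I.isGreatest_LPOPT.2 (I.sum_typeProb_mul_detValue_mem_lpValues A)

end KnownIIDInput

end

theorem lemma4p1 {U V : Type*} [Fintype U] [DecidableEq U] [Fintype V]
    (I : KnownIIDInput U V) :
    IsGreatest I.lpValues I.LPOPT ∧ I.OPT ≤ I.LPOPT :=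
  ⟨I.isGreatest_LPOPT, I.OPT_le_LPOPT⟩
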